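/- Let $K$ be a finite field of characteristic $p$ and let $G$ be a finite group. Then the following are equivalent: (a) the group algebra $KG$ is code-checkable, that is, every right ideal $I$ of $KG$ is the right annihilator of a single element: there is $v \in KG$ with $I = \{a \in KG : va = 0\}$; (b) $G$ is $p$-nilpotent, that is, $G$ has a normal subgroup of order prime to $p$ whose index is a power of $p$, and $G$ has a cyclic Sylow $p$-subgroup. -/

import Mathlib

/-- The right annihilator `{a | ∀ c ∈ C, c * a = 0}` of a subset `C` of a ring `A`,
as a right ideal, that is, as a submodule of `A` over the opposite ring. -/
def rightAnnihilator {A : Type*} [Ring A] (C : Set A) : Submodule Aᵐᵒᵖ A where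
  carrier := {a | ∀ c ∈ C, c * a = 0}
  add_mem' := by
    intro a b ha hb c hc
    rw [mul_add, ha c hc, hb c hc, add_zero]
  zero_mem' := by
    intro c _
    exact mul_zero c
  smul_mem' := by
    intro r a ha c hc
    change c * (a * MulOpposite.unop r) = 0
    rw [← mul_assoc, ha c hc, zero_mul]

/-- A right ideal is checkable if it is the right annihilator of a single element. -/
def IsCheckable {A : Type*} [Ring A] (I : Submodule Aᵐᵒᵖ A) : Prop :=
  ∃ v : A, I = rightAnnihilator {v}

/-- The group algebra `KG` is code-checkable if all its right ideals are checkable. -/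
def IsCodeCheckable (K G : Type*) [Field K] [Group G] : Prop :=
  ∀ I : Submodule (MonoidAlgebra K G)ᵐᵒᵖ (MonoidAlgebra K G), IsCheckable I

/-- A finite group is `p`-nilpotent if it has a normal `p`-complement: a normal subgroup
of order prime to `p` whose index is a power of `p`. -/
def IsPNilpotentGroup (p : ℕ) (G : Type*) [Group G] : Prop :=
  ∃ N : Subgroup G, N.Normal ∧ (Nat.card N).Coprime p ∧ ∃ k : ℕ, N.index = p ^ k

/-! The form `(x * y).coeff 1` on KG is nondegenerate and symmetric, so left and right annihilators
are inverse bijections between left and right ideals. Checkability of all right ideals therefore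
means that all left ideals are principal (`isCodeCheckable_iff_forall_ideal`).

If they are, write the augmentation ideal as KGv and let w be an idempotent power of v. Each KGv^n
is two-sided, and the g with g - 1 ∈ KGw form a normal p-complement N. In the p-group G/N the image
of v is nilpotent, so K[G/N] is spanned by powers of it; comparing its dimension with the exponent
makes G/N cyclic, and a Sylow p-subgroup embeds in G/N.

Conversely, G = ⟨x⟩N, so KG consists of polynomials in the unit x over KN, which is semisimple by
Maschke and normalized by x. Left ideals of such a ring are principal, by induction on the degree,
with idempotents as constant terms (`exists_generator_inter_skewFiltration`). -/

/-! ### Left ideals in rings generated by a normalizing unit over a semisimple subring -/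

section SkewFiltration

variable {A : Type*} [Ring A]

/-- The set of elements `∑ i < n, y ^ i * r i` with coefficients `r i` in the subring `R`. -/
def skewFiltration (R : Subring A) (y : A) : ℕ → Set A
  | 0 => {0}
  | n + 1 => {a | ∃ r ∈ R, ∃ u ∈ skewFiltration R y n, a = r + y * u}

variable {R : Subring A} {y : A}

theorem zero_mem_skewFiltration (n : ℕ) : (0 : A) ∈ skewFiltration R y n := by
  induction n with
  | zero => rfl
  | succ n ih => exact ⟨0, R.zero_mem, 0, ih, by simp⟩

theorem add_mem_skewFiltration {n : ℕ} {a b : A} (ha : a ∈ skewFiltration R y n)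
    (hb : b ∈ skewFiltration R y n) : a + b ∈ skewFiltration R y n := by
  induction n generalizing a b with
  | zero =>
    rw [show a = 0 from ha, show b = 0 from hb, add_zero]
    rfl
  | succ n ih =>
    obtain ⟨r, hr, u, hu, rfl⟩ := ha
    obtain ⟨s, hs, v, hv, rfl⟩ := hb
    exact ⟨r + s, R.add_mem hr hs, u + v, ih hu hv, by rw [mul_add]; abel⟩

theorem skewFiltration_mono {m n : ℕ} (h : m ≤ n) :
    skewFiltration R y m ⊆ skewFiltration R y n := by
  induction m generalizing n with
  | zero =>
    rintro a rfl
    exact zero_mem_skewFiltration n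
  | succ m ih =>
    obtain ⟨n, rfl⟩ : ∃ k, n = k + 1 := ⟨n - 1, by omega⟩
    rintro a ⟨r, hr, u, hu, rfl⟩
    exact ⟨r, hr, u, ih (by omega) hu, rfl⟩

theorem pow_mul_mem_skewFiltration {r : A} (hr : r ∈ R) (i : ℕ) :
    y ^ i * r ∈ skewFiltration R y (i + 1) := by
  induction i with
  | zero => exact ⟨r, hr, 0, rfl, by simp⟩
  | succ i ih => exact ⟨0, R.zero_mem, _, ih, by rw [pow_succ', mul_assoc, zero_add]⟩

variable {y : Aˣ}

theorem mul_mem_skewFiltration (hy : ∀ r ∈ R, (↑y⁻¹ : A) * r * y ∈ R) {n : ℕ} {r a : A}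
    (hr : r ∈ R) (ha : a ∈ skewFiltration R (y : A) n) : r * a ∈ skewFiltration R (y : A) n := by
  induction n generalizing r a with
  | zero =>
    rw [show a = 0 from ha, mul_zero]
    rfl
  | succ n ih =>
    obtain ⟨s, hs, u, hu, rfl⟩ := ha
    refine ⟨r * s, R.mul_mem hr hs, _, ih (hy r hr) hu, ?_⟩
    simp [mul_add, mul_assoc]

/-- In a semisimple subring, the annihilator of an idempotent `e` in a left ideal containing `e`
is generated by an idempotent orthogonal to `e`. -/
theorem exists_orthogonal_idempotent_generator [IsSemisimpleRing R] (I : Ideal R) {e : R}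
    (heI : e ∈ I) (he : e * e = e) :
    ∃ f ∈ I, f * f = f ∧ e * f = 0 ∧ f * e = 0 ∧ ∀ r ∈ I, r * (e + f) = r := by
  obtain ⟨f, hf, hI⟩ := IsSemisimpleRing.ideal_eq_span_idempotent
    (I ⊓ LinearMap.ker (LinearMap.toSpanSingleton R R e))
  have hfmem : f ∈ I ⊓ LinearMap.ker (LinearMap.toSpanSingleton R R e) :=
    hI ▸ Ideal.mem_span_singleton_self f
  have hfe : f * e = 0 := hfmem.2
  have hgen : ∀ r ∈ I, r * e = 0 → r * f = r := by
    intro r hr hre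
    have : r ∈ Ideal.span {f} := hI ▸ ⟨hr, hre⟩
    obtain ⟨s, rfl⟩ := Ideal.mem_span_singleton'.1 this
    rw [mul_assoc, hf.eq]
  refine ⟨f - e * f, I.sub_mem hfmem.1 (I.mul_mem_left e hfmem.1), ?_, ?_, ?_, fun r hr => ?_⟩
  · have h1 : f * (e * f) = 0 := by rw [← mul_assoc, hfe, zero_mul]
    simp [sub_mul, mul_sub, mul_assoc, h1, hf.eq]
  · rw [mul_sub, ← mul_assoc, he, sub_self]
  · rw [sub_mul, mul_assoc, hfe, mul_zero, sub_zero]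
  · have h1 := hgen (r - r * e) (I.sub_mem hr (I.mul_mem_left r heI))
      (by rw [sub_mul, mul_assoc, he, sub_self])
    rw [sub_mul, mul_assoc] at h1
    rw [mul_add, mul_sub, h1]
    abel

/-- The left ideal of leading coefficients, at level `n`, of elements of a left ideal `L`. -/
def leadingIdeal (hy : ∀ r ∈ R, (↑y⁻¹ : A) * r * y ∈ R) (L : Ideal A) (n : ℕ) : Ideal R where
  carrier := {r | ∃ u ∈ skewFiltration R (y : A) n, (r : A) + y * u ∈ L}
  add_mem' := by
    rintro r s ⟨u, hu, hru⟩ ⟨v, hv, hsv⟩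
    refine ⟨u + v, add_mem_skewFiltration hu hv, ?_⟩
    convert L.add_mem hru hsv using 1
    rw [mul_add, R.coe_add]
    abel
  zero_mem' := ⟨0, zero_mem_skewFiltration n, by simp⟩
  smul_mem' := by
    rintro s r ⟨u, hu, hru⟩
    refine ⟨_, mul_mem_skewFiltration hy (hy s s.2) hu, ?_⟩
    convert L.mul_mem_left s hru using 1
    simp [mul_add, mul_assoc]

/-- Constant terms are enlarged by orthogonal idempotents, so the old generator can be recovered
from the new one by multiplying by `e`; the condition `e * g = g` carries this through the
induction. The generator itself may have degree one above the level it serves. -/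
theorem exists_generator_inter_skewFiltration [IsSemisimpleRing R]
    (hy : ∀ r ∈ R, (↑y⁻¹ : A) * r * y ∈ R) (L : Ideal A) (n : ℕ) :
    ∃ e : R, ∃ g ∈ L, e * e = e ∧ e * g = g ∧
      (∃ u ∈ skewFiltration R (y : A) n, g = e + y * u) ∧
      ∀ a ∈ L, a ∈ skewFiltration R (y : A) n → ∃ b, a = b * g := by
  induction n with
  | zero =>
    refine ⟨0, 0, L.zero_mem, by simp, by simp, ⟨0, rfl, by simp⟩, fun a _ ha => ⟨0, ?_⟩⟩
    rw [mul_zero]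
    exact ha
  | succ n ih =>
    obtain ⟨e, g, hgL, he, heg, ⟨u, hu, hgu⟩, hgen⟩ := ih
    have heI : e ∈ leadingIdeal hy L n := ⟨u, hu, hgu ▸ hgL⟩
    obtain ⟨f, ⟨w, hw, hfw⟩, hff, hef, hfe, hI⟩ :=
      exists_orthogonal_idempotent_generator _ heI he
    have hef' : (e : A) * f = 0 := by exact_mod_cast hef
    have hfe' : (f : A) * e = 0 := by exact_mod_cast hfe
    have hff' : (f : A) * f = f := by exact_mod_cast hff
    have hfg : (f : A) * g = 0 := by rw [← heg, ← mul_assoc, hfe', zero_mul]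
    -- The factor `f` keeps the constant term `f` and gives `e * h = 0`.
    set h : A := f * (f + y * w) with hh
    have hhL : h ∈ L := L.mul_mem_left _ hfw
    have hfh : (f : A) * h = h := by rw [hh, ← mul_assoc, hff']
    have heh : (e : A) * h = 0 := by rw [hh, ← mul_assoc, hef', zero_mul]
    set t : A := u + (↑y⁻¹ * f * y) * w with ht
    have htU : t ∈ skewFiltration R (y : A) n :=
      add_mem_skewFiltration hu (mul_mem_skewFiltration hy (hy f f.2) hw)
    have hght : g + h = ((e + f : R) : A) + y * t := by
      rw [hgu, hh, ht, mul_add, hff', R.coe_add]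
      simp only [mul_add, ← mul_assoc, Units.mul_inv, one_mul]
      abel
    clear_value t
    have hegh : (e : A) * (g + h) = g := by rw [mul_add, heg, heh, add_zero]
    refine ⟨e + f, g + h, L.add_mem hgL hhL, ?_, ?_, ⟨t, skewFiltration_mono n.le_succ htU, hght⟩,
      ?_⟩
    · rw [mul_add, add_mul, add_mul, he, hff, hef, hfe, add_zero, zero_add]
    · rw [R.coe_add, add_mul, hegh, mul_add, hfg, hfh, zero_add]
    · rintro a haL ⟨r, hr, z, hz, rfl⟩
      have hre := hI ⟨r, hr⟩ ⟨z, hz, haL⟩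
      have hre' : r * ((e + f : R) : A) = r := congrArg Subtype.val hre
      -- Subtracting `r * (g + h)` cancels the constant term. As `y` is a unit, the remaining factor
      -- `z'` is again in `L`, one degree lower.
      set z' : A := z + (↑y⁻¹ * (-r) * y) * t with hz'
      have hzz : r + y * z - r * (g + h) = y * z' := by
        rw [hght, mul_add, hre', hz', mul_add]
        simp only [← mul_assoc, Units.mul_inv, one_mul, mul_neg, neg_mul]
        abel
      have hyz : y * z' ∈ L := hzz ▸ L.sub_mem haL (L.mul_mem_left r (L.add_mem hgL hhL))
      have hzL : z' ∈ L := by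
        have := L.mul_mem_left (↑y⁻¹ : A) hyz
        rwa [Units.inv_mul_cancel_left] at this
      obtain ⟨b, hb⟩ := hgen z' hzL
        (add_mem_skewFiltration hz (mul_mem_skewFiltration hy (hy _ (R.neg_mem hr)) htU))
      refine ⟨r + y * b * e, ?_⟩
      rw [add_mul, mul_assoc (y * b : A), hegh, mul_assoc, ← hb, ← hzz]
      abel

/-- If a ring is generated over a semisimple subring by a normalizing unit, in the sense that
every element is a polynomial in that unit, then all its left ideals are principal. -/
theorem isPrincipal_of_skewFiltration [IsSemisimpleRing R]
    (hy : ∀ r ∈ R, (↑y⁻¹ : A) * r * y ∈ R) (L : Ideal A) {n : ℕ}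
    (hn : ∀ a, a ∈ skewFiltration R (y : A) n) :
    ∃ v, ∀ a, a ∈ L ↔ ∃ b, a = b * v := by
  obtain ⟨e, g, hgL, -, -, -, hgen⟩ := exists_generator_inter_skewFiltration hy L n
  exact ⟨g, fun a => ⟨fun ha => hgen a ha (hn a), fun ⟨b, hb⟩ => hb ▸ L.mul_mem_left b hgL⟩⟩

end SkewFiltration

/-! ### Annihilator duality in group algebras -/

namespace MonoidAlgebra

section Duality

variable {K G : Type*} [Field K] [Group G]

/-- Linear functionals on a group algebra are represented by the trace form. -/
theorem exists_forall_apply_eq_coeff_mul [Finite G] (f : MonoidAlgebra K G →ₗ[K] K) :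
    ∃ b : MonoidAlgebra K G, ∀ x, (x * b).coeff 1 = f x ∧ (b * x).coeff 1 = f x := by
  have : Fintype G := Fintype.ofFinite G
  refine ⟨ofCoeff (Finsupp.equivFunOnFinite.symm fun g => f (single g⁻¹ 1)), fun x => ?_⟩
  induction x using induction_linear with
  | zero => simp
  | add x y hx hy => simp [add_mul, mul_add, hx.1, hx.2, hy.1, hy.2]
  | single g r =>
    have : f (single g r) = r * f (single g 1) := by
      rw [← smul_eq_mul, ← map_smul, smul_single', mul_one]
    simp [this, mul_comm]

theorem eq_zero_of_forall_coeff_single_mul {x : MonoidAlgebra K G}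
    (h : ∀ g, (single g 1 * x).coeff 1 = 0) : x = 0 := by
  ext g
  simpa using h g⁻¹

theorem eq_zero_of_forall_coeff_mul_single {x : MonoidAlgebra K G}
    (h : ∀ g, (x * single g 1).coeff 1 = 0) : x = 0 := by
  ext g
  simpa using h g⁻¹

/-- Left ideals of the group algebra of a finite group are double annihilators. -/
theorem mem_of_forall_mul_eq_zero [Finite G] (L : Ideal (MonoidAlgebra K G)) {a : MonoidAlgebra K G}
    (ha : ∀ b, (∀ x ∈ L, x * b = 0) → a * b = 0) : a ∈ L := by
  by_contra haL
  obtain ⟨f, hfa, hf⟩ := (L.restrictScalars K).exists_le_ker_of_notMem haL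
  obtain ⟨b, hb⟩ := exists_forall_apply_eq_coeff_mul f
  refine hfa ?_
  -- The functional vanishes on `L`, which is stable under left translation, so every coefficient of
  -- `x * b` is zero for `x` in `L`.
  rw [← (hb a).1, ha b fun x hx => eq_zero_of_forall_coeff_single_mul fun g => ?_]
  · simp
  · rw [← mul_assoc, (hb _).1]
    exact hf (L.mul_mem_left _ hx)

/-- Right ideals of the group algebra of a finite group are double annihilators. -/
theorem mem_of_forall_mul_eq_zero_right [Finite G]
    (I : Submodule (MonoidAlgebra K G)ᵐᵒᵖ (MonoidAlgebra K G)) {a : MonoidAlgebra K G}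
    (ha : ∀ b, (∀ x ∈ I, b * x = 0) → b * a = 0) : a ∈ I := by
  by_contra haL
  let I' : Submodule K (MonoidAlgebra K G) :=
    { I.toAddSubmonoid with
      smul_mem' := fun c x hx => by
        have : c • x = MulOpposite.op (c • (1 : MonoidAlgebra K G)) • x := by simp
        rw [this]
        exact I.smul_mem _ hx }
  obtain ⟨f, hfa, hf⟩ := I'.exists_le_ker_of_notMem haL
  obtain ⟨b, hb⟩ := exists_forall_apply_eq_coeff_mul f
  refine hfa ?_
  rw [← (hb a).2, ha b fun x hx => eq_zero_of_forall_coeff_mul_single fun g => ?_]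
  · simp
  · rw [mul_assoc, (hb _).2]
    exact hf (I.smul_mem (MulOpposite.op (single g 1)) hx)

end Duality

end MonoidAlgebra

/-- The right annihilator of `v` is that of the left ideal generated by `v`, so under the duality
checkable right ideals match principal left ideals. -/
theorem isCodeCheckable_iff_forall_ideal {K G : Type*} [Field K] [Group G] [Finite G] :
    IsCodeCheckable K G ↔
      ∀ L : Ideal (MonoidAlgebra K G), ∃ v, ∀ a, a ∈ L ↔ ∃ b, a = b * v := by
  constructor
  · intro h L
    obtain ⟨v, hv⟩ := h (rightAnnihilator (L : Set (MonoidAlgebra K G)))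
    have hv' : ∀ b, (∀ x ∈ L, x * b = 0) ↔ v * b = 0 := fun b => by
      have := SetLike.ext_iff.1 hv b
      simpa [rightAnnihilator] using this
    refine ⟨v, fun a => ⟨fun ha => ?_, ?_⟩⟩
    · have : a ∈ Ideal.span {v} := by
        refine MonoidAlgebra.mem_of_forall_mul_eq_zero _ fun b hb => ?_
        exact (hv' b).2 (hb v (Ideal.mem_span_singleton_self v)) a ha
      obtain ⟨b, hb⟩ := Ideal.mem_span_singleton'.1 this
      exact ⟨b, hb.symm⟩
    · rintro ⟨b, rfl⟩
      refine L.mul_mem_left b (MonoidAlgebra.mem_of_forall_mul_eq_zero L fun c hc => ?_)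
      exact (hv' c).1 hc
  · intro h I
    let L : Ideal (MonoidAlgebra K G) :=
      { carrier := {a | ∀ x ∈ I, a * x = 0}
        add_mem' := fun ha hb x hx => by rw [add_mul, ha x hx, hb x hx, add_zero]
        zero_mem' := fun x _ => zero_mul x
        smul_mem' := fun c a ha x hx => by rw [smul_eq_mul, mul_assoc, ha x hx, mul_zero] }
    obtain ⟨v, hv⟩ := h L
    refine ⟨v, Submodule.ext fun a => ⟨fun ha c hc => ?_, fun ha => ?_⟩⟩
    · rw [Set.mem_singleton_iff.1 hc]
      exact (hv v).2 ⟨1, (one_mul v).symm⟩ a ha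
    · refine MonoidAlgebra.mem_of_forall_mul_eq_zero_right I fun b hb => ?_
      obtain ⟨c, rfl⟩ := (hv b).1 hb
      rw [mul_assoc, ha v rfl, mul_zero]

/-! ### Idempotent powers, and p-subgroups modulo a normal p'-subgroup -/

/-- Every element of a finite monoid has an idempotent power. -/
theorem exists_isIdempotentElem_pow {M : Type*} [Monoid M] [Finite M] (v : M) :
    ∃ m, 0 < m ∧ IsIdempotentElem (v ^ m) := by
  obtain ⟨i, j, hne, hij⟩ := Finite.exists_ne_map_eq_of_infinite fun n : ℕ => v ^ n
  wlog h : i < j generalizing i j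
  · exact this j i hne.symm hij.symm (by omega)
  have hij : v ^ i = v ^ j := hij
  obtain ⟨d, rfl⟩ := Nat.exists_eq_add_of_lt h
  have hper : ∀ n, v ^ (i + n) = v ^ (i + n + (d + 1)) := fun n => by
    rw [pow_add, hij, ← pow_add]
    congr 1
    omega
  have hper' : ∀ k n, v ^ (i + n) = v ^ (i + n + k * (d + 1)) := by
    intro k
    induction k with
    | zero => simp
    | succ k ih =>
      intro n
      rw [ih n, add_assoc, hper]
      congr 1
      ring
  -- A multiple of the period `d + 1` lying beyond the preperiod `i`; the factor `i + 1` keeps it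
  -- positive when `i = 0`.
  refine ⟨(i + 1) * (d + 1), by positivity, ?_⟩
  obtain ⟨n, hn⟩ := Nat.exists_eq_add_of_le (show i ≤ (i + 1) * (d + 1) by nlinarith)
  have := hper' (i + 1) n
  rw [← hn] at this
  rw [IsIdempotentElem, ← pow_add, ← this]

theorem IsPGroup.injective_mk'_comp_subtype {p : ℕ} [Fact p.Prime] {G : Type*} [Group G] [Finite G]
    {P : Subgroup G} (hP : IsPGroup p P) (N : Subgroup G) [N.Normal]
    (hN : (Nat.card N).Coprime p) :
    Function.Injective ((QuotientGroup.mk' N).comp P.subtype) := by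
  obtain ⟨k, hk⟩ := IsPGroup.iff_card.1 hP
  have hdisj : Disjoint N P := Subgroup.disjoint_of_coprime_natCard (hk ▸ hN.pow_right k)
  rw [injective_iff_map_eq_one]
  intro x hx
  have hxN : (x : G) ∈ N := (QuotientGroup.eq_one_iff (x : G)).1 hx
  exact Subtype.ext (Subgroup.disjoint_def.1 hdisj hxN x.2)

/-! ### Principal augmentation ideals -/

namespace MonoidAlgebra

variable {K G : Type*} [Field K] [Group G]

/-- The augmentation map of a group algebra. -/
noncomputable def augmentation (K G : Type*) [Field K] [Group G] : MonoidAlgebra K G →ₐ[K] K :=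
  lift K K G 1

@[simp]
theorem augmentation_single (g : G) (r : K) : augmentation K G (single g r) = r := by
  simp [augmentation]

theorem augmentation_eq_sum [Fintype G] (x : MonoidAlgebra K G) :
    augmentation K G x = ∑ g, x.coeff g := by
  simp [augmentation, lift_apply, Finsupp.sum_fintype]

/-- The element `v` generates the augmentation ideal as a left ideal. -/
def IsAugmentationGenerator (v : MonoidAlgebra K G) : Prop :=
  ∀ a, augmentation K G a = 0 ↔ ∃ b, a = b * v

namespace IsAugmentationGenerator

variable {v : MonoidAlgebra K G}

theorem augmentation_eq_zero (hv : IsAugmentationGenerator v) : augmentation K G v = 0 :=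
  (hv v).2 ⟨1, (one_mul v).symm⟩

/-- The augmentation ideal is two-sided, so `v` can be moved past any element at the cost of
changing that element. -/
theorem exists_pow_mul_eq (hv : IsAugmentationGenerator v) (n : ℕ) (a : MonoidAlgebra K G) :
    ∃ b, v ^ n * a = b * v ^ n := by
  induction n with
  | zero => exact ⟨a, by simp⟩
  | succ n ih =>
    obtain ⟨b, hb⟩ := ih
    obtain ⟨c, hc⟩ := (hv (v * b)).1 (by rw [map_mul, hv.augmentation_eq_zero, zero_mul])
    exact ⟨c, by rw [pow_succ', mul_assoc, hb, ← mul_assoc, hc, mul_assoc]⟩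

theorem exists_pow_eq (hv : IsAugmentationGenerator v) {x : MonoidAlgebra K G}
    (hx : augmentation K G x = 0) (n : ℕ) : ∃ b, x ^ n = b * v ^ n := by
  induction n with
  | zero => exact ⟨1, by simp⟩
  | succ n ih =>
    obtain ⟨a, rfl⟩ := (hv x).1 hx
    obtain ⟨b, hb⟩ := ih
    obtain ⟨c, hc⟩ := hv.exists_pow_mul_eq n a
    refine ⟨b * c, ?_⟩
    rw [pow_succ, hb, mul_assoc, ← mul_assoc _ a, hc, mul_assoc, mul_assoc, ← pow_succ]

theorem map {H : Type*} [Group H] (hv : IsAugmentationGenerator v) {f : G →* H}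
    (hf : Function.Surjective f) :
    IsAugmentationGenerator (mapDomainRingHom K f v) := by
  have haug : ∀ x, augmentation K H (mapDomainRingHom K f x) = augmentation K G x := fun x => by
    induction x using induction_linear with
    | zero => simp
    | add x y hx hy => simp only [map_add, hx, hy]
    | single g r => simp
  have hsurj : Function.Surjective (mapDomainRingHom K f) := fun x => by
    induction x using induction_linear with
    | zero => exact ⟨0, map_zero _⟩
    | add x y hx hy =>
      obtain ⟨a, rfl⟩ := hx
      obtain ⟨b, rfl⟩ := hy
      exact ⟨a + b, map_add _ a b⟩
    | single h r =>
      obtain ⟨g, rfl⟩ := hf h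
      exact ⟨single g r, by simp⟩
  intro a
  constructor
  · intro ha
    obtain ⟨a, rfl⟩ := hsurj a
    obtain ⟨b, rfl⟩ := (hv a).1 (haug a ▸ ha)
    exact ⟨_, map_mul _ b v⟩
  · rintro ⟨b, rfl⟩
    rw [map_mul, haug, hv.augmentation_eq_zero, mul_zero]

/-- A Taylor expansion: the remainder `b` is its augmentation plus a left multiple of `v`. For
nilpotent `v` the powers of `v` thus span KG. -/
theorem exists_eq_sum_add (hv : IsAugmentationGenerator v) (n : ℕ) (x : MonoidAlgebra K G) :
    ∃ (f : ℕ → K) (b : MonoidAlgebra K G), x = ∑ i ∈ Finset.range n, f i • v ^ i + b * v ^ n := by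
  induction n with
  | zero => exact ⟨0, x, by simp⟩
  | succ n ih =>
    obtain ⟨f, b, hb⟩ := ih
    obtain ⟨c, hc⟩ := (hv (b - algebraMap K _ (augmentation K G b))).1 (by simp)
    refine ⟨Function.update f n (augmentation K G b), c, ?_⟩
    have hsum : ∑ i ∈ Finset.range n, Function.update f n (augmentation K G b) i • v ^ i =
        ∑ i ∈ Finset.range n, f i • v ^ i := Finset.sum_congr rfl fun i hi => by
      rw [Function.update_of_ne (Finset.mem_range.1 hi).ne]
    rw [Finset.sum_range_succ, Function.update_self, hsum, hb, pow_succ', ← mul_assoc, ← hc,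
      sub_mul, ← Algebra.smul_def]
    abel

end IsAugmentationGenerator

/-- If a subgroup fixes an element with nonzero augmentation, its order is invertible. -/
theorem natCard_ne_zero_of_forall_single_mul_eq [Finite G] (N : Subgroup G)
    {c : MonoidAlgebra K G} (hc : ∀ n ∈ N, single n 1 * c = c) (h : augmentation K G c ≠ 0) :
    (Nat.card N : K) ≠ 0 := by
  have : Fintype G := Fintype.ofFinite G
  have : Fintype N := Fintype.ofFinite N
  have : Fintype (G ⧸ N) := Fintype.ofFinite _
  intro hN
  apply h
  have hbij : Function.Bijective fun x : (G ⧸ N) × N => x.1.out * x.2 := by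
    constructor
    · rintro ⟨q, n⟩ ⟨q', n'⟩ h
      have hq : q = q' := by
        have := congrArg (QuotientGroup.mk (s := N)) h
        simpa using this
      subst hq
      simpa using h
    · intro g
      refine ⟨(g, ⟨(g : G ⧸ N).out⁻¹ * g, ?_⟩), by simp⟩
      exact QuotientGroup.eq.1 (QuotientGroup.out_eq' _)
  -- The coefficients of `c` are constant on right cosets of `N`, while `G ⧸ N` consists of left
  -- cosets; inversion exchanges them. Each coset then contributes a multiple of `Nat.card N`.
  rw [augmentation_eq_sum, ← Equiv.sum_comp (Equiv.inv G), ← hbij.sum_comp, Fintype.sum_prod_type]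
  refine Finset.sum_eq_zero fun q _ => ?_
  have hconst : ∀ n : N, c.coeff (q.out * n)⁻¹ = c.coeff q.out⁻¹ := fun n => by
    conv_rhs => rw [← hc n n.2]
    simp
  simp only [Equiv.inv_apply, hconst]
  simp [← Nat.card_eq_fintype_card, hN]

/-! ### The normal p-complement and the cyclic Sylow subgroup -/

section CharP

variable (p : ℕ) [CharP K p]

theorem charP_monoidAlgebra : CharP (MonoidAlgebra K G) p :=
  charP_of_injective_algebraMap (algebraMap K (MonoidAlgebra K G)).injective p

variable [Fact p.Prime]

theorem IsAugmentationGenerator.isPNilpotentGroup [Finite K] [Finite G] {v : MonoidAlgebra K G}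
    (hv : IsAugmentationGenerator v) : IsPNilpotentGroup p G := by
  have := charP_monoidAlgebra (K := K) (G := G) p
  have : Finite (MonoidAlgebra K G) := .of_injective (fun x => (x.coeff : G → K)) (fun x y h => by
    ext g; exact congrFun h g)
  obtain ⟨m, hm, hw⟩ := exists_isIdempotentElem_pow v
  set w := v ^ m with hwv
  have hcomm := hv.exists_pow_mul_eq m
  rw [← hwv] at hcomm
  have haugw : augmentation K G w = 0 := by
    rw [hwv, map_pow, hv.augmentation_eq_zero, zero_pow hm.ne']
  have hwc : w * (1 - w) = 0 := by rw [mul_sub, mul_one, hw.eq, sub_self]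
  have hfix : ∀ g : G, single g 1 * (1 - w) = 1 - w ↔ ∃ b, single g 1 - 1 = b * w := by
    intro g
    constructor
    · intro h
      exact ⟨single g 1 - 1, by rw [mul_sub, mul_one] at h; rw [sub_mul, one_mul]; grind⟩
    · rintro ⟨b, hb⟩
      rw [← sub_eq_zero, ← sub_one_mul, hb, mul_assoc, hwc, mul_zero]
  -- By `hfix`, membership means `g - 1 ∈ KGw`; as this ideal is two-sided, `N` is normal.
  let N : Subgroup G :=
    { carrier := {g | single g 1 * (1 - w) = 1 - w}
      mul_mem' := fun {a b} ha hb => by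
        simp only [Set.mem_ofPred_eq] at ha hb ⊢
        rw [← mul_one (1 : K), ← single_mul_single, mul_assoc, hb, ha]
      one_mem' := by simp [← one_def]
      inv_mem' := fun {a} ha => by
        simp only [Set.mem_ofPred_eq] at ha ⊢
        nth_rw 1 [← ha]
        rw [← mul_assoc, single_mul_single]
        simp [← one_def] }
  have hNmem : ∀ g, g ∈ N ↔ single g 1 * (1 - w) = 1 - w := fun _ => Iff.rfl
  have hN : N.Normal := by
    refine ⟨fun n hn g => ?_⟩
    rw [hNmem, hfix] at hn ⊢
    obtain ⟨b, hb⟩ := hn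
    obtain ⟨c, hc⟩ := hcomm (single g⁻¹ 1)
    refine ⟨single g 1 * b * c, ?_⟩
    rw [mul_assoc _ c, ← hc, ← mul_assoc, mul_assoc _ b, ← hb, mul_sub, sub_mul]
    simp [single_mul_single, one_def, mul_assoc]
  have hNp : (Nat.card N : K) ≠ 0 := by
    refine natCard_ne_zero_of_forall_single_mul_eq N (fun n hn => hn) ?_
    rw [map_sub, haugw, map_one, sub_zero]
    exact one_ne_zero
  have hquot : IsPGroup p (G ⧸ N) := by
    intro q
    induction q using QuotientGroup.induction_on with | H g => ?_
    refine ⟨m, ?_⟩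
    rw [← QuotientGroup.mk_pow, QuotientGroup.eq_one_iff, hNmem, hfix]
    -- In characteristic p, `g ^ p ^ m - 1 = (g - 1) ^ p ^ m`, which lies in KGw because `p ^ m ≥
    -- m`.
    obtain ⟨b, hb⟩ := hv.exists_pow_eq (x := single g 1 - 1) (by simp) m
    obtain ⟨k, hk⟩ := Nat.exists_eq_add_of_le (Nat.lt_pow_self (n := m) (Fact.out : p.Prime).one_lt).le
    refine ⟨(single g 1 - 1) ^ k * b, ?_⟩
    rw [mul_assoc, ← hb, ← pow_add, add_comm, ← hk,
      sub_pow_char_pow_of_commute p m (Commute.one_right _), single_pow, one_pow, one_pow]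
  refine ⟨N, hN, ?_, ?_⟩
  · refine ((Nat.Prime.coprime_iff_not_dvd Fact.out).2 fun h => hNp ?_).symm
    exact (CharP.cast_eq_zero_iff K p _).2 h
  · obtain ⟨k, hk⟩ := IsPGroup.iff_card.1 hquot
    exact ⟨k, hk⟩

/-- An element of the group algebra fixed by left translations absorbs the augmentation ideal. -/
theorem mul_eq_augmentation_smul {z : MonoidAlgebra K G} (hz : ∀ g : G, single g 1 * z = z)
    (x : MonoidAlgebra K G) : z * x = augmentation K G x • z := by
  have hconst : ∀ g h, z.coeff g = z.coeff h := fun g h => by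
    conv_rhs => rw [← hz (h * g⁻¹)]
    simp
  induction x using induction_linear with
  | zero => simp
  | add x y hx hy => rw [mul_add, hx, hy, map_add, add_smul]
  | single g r =>
    ext h
    simp [mul_comm, hconst (h * g⁻¹) h]

/-- Otherwise the p-group `G` has a nonzero fixed point `z` in the nonzero left ideal KGw, with w an
idempotent power of `v`. Then `z = z * w`, but a fixed point is killed by elements of augmentation
zero. -/
theorem IsAugmentationGenerator.isNilpotent [Finite K] [Finite G] (hG : IsPGroup p G)
    {v : MonoidAlgebra K G} (hv : IsAugmentationGenerator v) : IsNilpotent v := by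
  have := charP_monoidAlgebra (K := K) (G := G) p
  have : Finite (MonoidAlgebra K G) := .of_injective (fun x => (x.coeff : G → K)) (fun x y h => by
    ext g; exact congrFun h g)
  obtain ⟨m, hm, hw⟩ := exists_isIdempotentElem_pow v
  refine ⟨m, ?_⟩
  by_contra hw0
  set w := v ^ m with hwv
  let L : Ideal (MonoidAlgebra K G) := Ideal.span {w}
  let _ : MulAction G L := MulAction.compHom L (of K G)
  have hw1 : (⟨w, Ideal.mem_span_singleton_self w⟩ : L) ≠ 0 := fun h => hw0 (congrArg Subtype.val h)
  have hcard : p ∣ Nat.card L := by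
    rw [← addOrderOf_eq_prime (p := p) _ hw1]
    · exact addOrderOf_dvd_natCard _
    · ext1
      change p • w = 0
      rw [nsmul_eq_mul, CharP.cast_eq_zero, zero_mul]
  obtain ⟨z, hz, hz0⟩ := hG.exists_fixed_point_of_prime_dvd_card_of_fixed_point L hcard
    (a := 0) fun g => smul_zero (of K G g)
  have hzfix : ∀ g : G, (single g 1 : MonoidAlgebra K G) * (z : MonoidAlgebra K G) = z := fun g =>
    congrArg (Subtype.val : L → MonoidAlgebra K G) (hz g)
  obtain ⟨b, hb⟩ := Ideal.mem_span_singleton'.1 z.2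
  have hzw : (z : MonoidAlgebra K G) * w = z := by rw [← hb, mul_assoc, hw.eq]
  apply hz0
  ext1
  rw [← hzw, mul_eq_augmentation_smul hzfix, hwv, map_pow, hv.augmentation_eq_zero,
    zero_pow hm.ne', zero_smul]
  rfl

/-- Powers of the nilpotent `v` span KG, so KG is commutative. If `G` has exponent `p ^ e`,
Frobenius gives `v ^ p ^ e = 0`, so `p ^ e` powers already span and the order of `G` is at most its
exponent. -/
theorem IsAugmentationGenerator.isCyclic [Finite K] [Finite G] (hG : IsPGroup p G)
    {v : MonoidAlgebra K G} (hv : IsAugmentationGenerator v) : IsCyclic G := by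
  have := charP_monoidAlgebra (K := K) (G := G) p
  obtain ⟨m, hm⟩ := hv.isNilpotent p hG
  have hcomm : ∀ x y : MonoidAlgebra K G, Commute x y := by
    intro x y
    obtain ⟨f, a, rfl⟩ := hv.exists_eq_sum_add m x
    obtain ⟨g, b, rfl⟩ := hv.exists_eq_sum_add m y
    rw [hm, mul_zero, mul_zero, add_zero, add_zero]
    exact .sum_left _ _ _ fun i _ => .sum_right _ _ _ fun j _ =>
      (((Commute.refl v).pow_pow i j).smul_left _).smul_right _
  let _ : CommGroup G :=
    { ‹Group G› with
      mul_comm := fun a b => of_injective (R := K) <| by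
        rw [map_mul, map_mul, (hcomm _ _).eq] }
  obtain ⟨k, hk⟩ := IsPGroup.iff_card.1 hG
  obtain ⟨e, -, he⟩ := (Nat.dvd_prime_pow (Fact.out : p.Prime)).1
    (hk ▸ Group.exponent_dvd_nat_card : Monoid.exponent G ∣ p ^ k)
  have hpow : ∀ x : MonoidAlgebra K G,
      x ^ p ^ e = algebraMap K (MonoidAlgebra K G) (augmentation K G x ^ p ^ e) := by
    intro x
    induction x using induction_linear with
    | zero => simp [(Fact.out : p.Prime).ne_zero]
    | add x y hx hy =>
      rw [add_pow_char_pow_of_commute p e (hcomm x y), hx, hy, map_add,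
        add_pow_char_pow_of_commute p e (Commute.all _ _), map_add]
    | single g r =>
      rw [single_pow, ← he, Monoid.pow_exponent_eq_one]
      simp
  have hv0 : v ^ p ^ e = 0 := by
    rw [hpow, hv.augmentation_eq_zero, zero_pow (pow_pos (Fact.out : p.Prime).pos e).ne', map_zero]
  have hle : Nat.card G ≤ p ^ e := by
    have hsurj : Function.Surjective
        (Fintype.linearCombination K fun i : Fin (p ^ e) => v ^ (i : ℕ)) := fun x => by
      obtain ⟨f, b, hb⟩ := hv.exists_eq_sum_add (p ^ e) x
      refine ⟨fun i => f i, ?_⟩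
      rw [hb, hv0, mul_zero, add_zero, Fintype.linearCombination_apply,
        Finset.sum_range fun i => f i • v ^ i]
    have := LinearMap.finrank_le_finrank_of_surjective hsurj
    rwa [Module.finrank_eq_nat_card_basis (basis G K), Module.finrank_fin_fun] at this
  refine IsCyclic.of_exponent_eq_card (le_antisymm ?_ ?_)
  · exact Nat.le_of_dvd Nat.card_pos Group.exponent_dvd_nat_card
  · exact he ▸ hle

theorem IsAugmentationGenerator.isCyclic_sylow [Finite K] [Finite G]
    {v : MonoidAlgebra K G} (hv : IsAugmentationGenerator v) (P : Sylow p G) : IsCyclic P := by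
  obtain ⟨N, hN, hcop, k, hk⟩ := hv.isPNilpotentGroup p
  have hq : IsPGroup p (G ⧸ N) := IsPGroup.of_card (n := k) hk
  have := (hv.map (QuotientGroup.mk'_surjective N)).isCyclic p hq
  exact isCyclic_of_injective _ (P.isPGroup'.injective_mk'_comp_subtype N hcop)

end CharP

end MonoidAlgebra

/-! ### From a normal p-complement and a cyclic Sylow subgroup to principal left ideals -/

/-- `P` embeds in `G ⧸ N`, whose order is a power of `p` dividing that of `G`, hence of `P`. So `P`
maps onto `G ⧸ N`, and a generator of `P` serves as `x`. -/
theorem Subgroup.exists_pow_mul_of_coprime {p : ℕ} [Fact p.Prime] {G : Type*} [Group G] [Finite G]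
    {N : Subgroup G} [N.Normal] (hN : (Nat.card N).Coprime p) {k : ℕ} (hk : N.index = p ^ k)
    (P : Sylow p G) [IsCyclic P] : ∃ x : G, ∀ g : G, ∃ i : ℕ, ∃ n ∈ N, g = x ^ i * n := by
  have hinj := P.isPGroup'.injective_mk'_comp_subtype N hN
  have hcard : Nat.card (G ⧸ N) ≤ Nat.card P := by
    change N.index ≤ _
    refine Nat.le_of_dvd Nat.card_pos (Nat.Coprime.dvd_of_dvd_mul_right (n := P.index) ?_ ?_)
    · rw [hk]
      exact ((Nat.Prime.coprime_iff_not_dvd Fact.out).2 P.not_dvd_index).pow_left k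
    · rw [(P : Subgroup G).card_mul_index]
      exact N.index_dvd_card
  have hsurj := (hinj.bijective_of_nat_card_le hcard).surjective
  obtain ⟨x, hx⟩ := IsCyclic.exists_generator (α := P)
  refine ⟨x, fun g => ?_⟩
  obtain ⟨y, hy⟩ := hsurj g
  obtain ⟨i, rfl⟩ := (mem_powers_iff_mem_zpowers.2 (hx y) : y ∈ Submonoid.powers x)
  refine ⟨i, ((x : G) ^ i)⁻¹ * g, QuotientGroup.eq.1 hy, by simp⟩

namespace MonoidAlgebra

variable {K G : Type*} [Field K] [Group G]

/-- The elements of a group algebra supported on a subgroup. -/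
noncomputable def subgroupSubring (K : Type*) [Field K] (N : Subgroup G) :
    Subring (MonoidAlgebra K G) :=
  (mapDomainRingHom K N.subtype).range

theorem single_mem_subgroupSubring {N : Subgroup G} {n : G} (hn : n ∈ N) (r : K) :
    single n r ∈ subgroupSubring K N :=
  ⟨single ⟨n, hn⟩ r, by simp⟩

theorem isSemisimpleRing_subgroupSubring [Finite G] {N : Subgroup G} (hN : (Nat.card N : K) ≠ 0) :
    IsSemisimpleRing (subgroupSubring K N) :=
  have : NeZero (Nat.card N : K) := ⟨hN⟩
  RingHom.isSemisimpleRing_of_surjective (mapDomainRingHom K N.subtype).rangeRestrict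
    (RingHom.rangeRestrict_surjective _)

theorem conj_mem_subgroupSubring {N : Subgroup G} [hN : N.Normal] (g : G) {a : MonoidAlgebra K G}
    (ha : a ∈ subgroupSubring K N) : single g⁻¹ 1 * a * single g 1 ∈ subgroupSubring K N := by
  obtain ⟨x, rfl⟩ := ha
  induction x using induction_linear with
  | zero => simp
  | add x y hx hy =>
    rw [map_add, mul_add, add_mul]
    exact add_mem hx hy
  | single n r =>
    simpa [single_mul_single] using
      single_mem_subgroupSubring (by simpa using hN.conj_mem n n.2 g⁻¹) r

/-- Left ideals are principal when the group is generated by a normal subgroup of invertible order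
and one further element. -/
theorem isPrincipal_of_forall_eq_pow_mul [Finite G] {N : Subgroup G} [N.Normal]
    (hN : (Nat.card N : K) ≠ 0) {x : G} (hx : ∀ g : G, ∃ i : ℕ, ∃ n ∈ N, g = x ^ i * n)
    (L : Ideal (MonoidAlgebra K G)) : ∃ v, ∀ a, a ∈ L ↔ ∃ b, a = b * v := by
  have := isSemisimpleRing_subgroupSubring hN
  let y : (MonoidAlgebra K G)ˣ := Units.map (of K G) (toUnits x)
  have hy1 : (y : MonoidAlgebra K G) = single x 1 := rfl
  have hy2 : (↑y⁻¹ : MonoidAlgebra K G) = single x⁻¹ 1 := rfl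
  choose i n hn hg using hx
  -- Finiteness of `G` bounds the exponents of `x` needed, so one level of the filtration is all of
  -- KG.
  obtain ⟨m, hm⟩ := (Set.finite_range i).bddAbove
  refine isPrincipal_of_skewFiltration (R := subgroupSubring K N) (y := y)
    (fun r hr => hy1 ▸ hy2 ▸ conj_mem_subgroupSubring x hr) L (n := m + 1) fun a => ?_
  induction a using induction_linear with
  | zero => exact zero_mem_skewFiltration _
  | add a b ha hb => exact add_mem_skewFiltration ha hb
  | single g r =>
    have h : single g r = (y : MonoidAlgebra K G) ^ i g * single (n g) r := by
      rw [hy1, single_pow, single_mul_single, one_pow, one_mul, ← hg]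
    rw [h]
    exact skewFiltration_mono (Nat.succ_le_succ (hm ⟨g, rfl⟩))
      (pow_mul_mem_skewFiltration (single_mem_subgroupSubring (hn g) r) _)

end MonoidAlgebra

theorem mainTheorem1 {K G : Type*} [Field K] [Finite K] [Group G] [Finite G]
    (p : ℕ) [Fact p.Prime] [CharP K p] :
    IsCodeCheckable K G ↔
      IsPNilpotentGroup p G ∧ ∃ P : Sylow p G, IsCyclic P := by
  rw [isCodeCheckable_iff_forall_ideal]
  constructor
  · intro h
    obtain ⟨v, hv⟩ := h (RingHom.ker (MonoidAlgebra.augmentation K G))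
    have hv' : MonoidAlgebra.IsAugmentationGenerator v := hv
    obtain ⟨P⟩ : Nonempty (Sylow p G) := inferInstance
    exact ⟨hv'.isPNilpotentGroup p, P, hv'.isCyclic_sylow p P⟩
  · rintro ⟨⟨N, hN, hcop, k, hk⟩, P, hP⟩ L
    obtain ⟨x, hx⟩ := N.exists_pow_mul_of_coprime hcop hk P
    refine MonoidAlgebra.isPrincipal_of_forall_eq_pow_mul (N := N) (fun h => ?_) hx L
    exact (Nat.Prime.coprime_iff_not_dvd Fact.out).1 hcop.symm ((CharP.cast_eq_zero_iff K p _).1 h)
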